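/- For integers $s,k,m$ let $A_{s,k}(m)$ be the maximum number of distinct letters in any finite sequence which can be partitioned into $m$ contiguous (possibly empty) blocks of pairwise distinct letters, in which every letter occurs at least $k$ times, and which has no subsequence $abab\cdots$ of length $s$ alternating between two distinct letters $a,b$ (with $A_{s,k}(m)=\infty$ if there is no maximum). Let $A_1(n)=2n$ and, for $d\ge 2$, $A_d(0)=1$ and $A_d(n)=A_{d-1}(A_d(n-1))$ for $n\ge 1$; for $d\ge1$ let $\alpha_d(x)=\min\{n\ge 0: A_d(n)\ge x\}$. Then: 1. for all $s\ge 2$ and all $m\ge 0$, $A_{s+1,s}(m)\le\binom{m-\lceil s/2\rceil}{\lfloor s/2\rfloor}$, where the binomial coefficient is read as $0$ when $m<s$; 2. $A_{5,k}(m)$ is finite for all $k\ge5$ and $m\ge0$, and, as $m\to\infty$, $A_{5,5}(m)=O(m\log m)$ and $A_{5,6}(m)=O(m\log\log m)$; 3. $A_{5,k}(m)=O\bigl(m\,\alpha_{\lfloor (k-1)/2\rfloor}(m)\bigr)$ for $k\ge 7$, with an absolute constant: there is a constant $C$ such that $A_{5,k}(m)\le C\,m\,\alpha_{\lfloor (k-1)/2\rfloor}(m)$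 for all $k\ge 7$ and all $m\ge 0$. -/

import Mathlib

open scoped Asymptotics

/-- The sequence `w` contains the sequence `u`: some subsequence `v` of `w` becomes `u` under a
one-to-one renaming of its letters.  Letters are natural numbers. -/
def SeqContains (w u : List ℕ) : Prop :=
  ∃ v : List ℕ, v.Sublist w ∧ ∃ f : ℕ → ℕ, Set.InjOn f {a | a ∈ v} ∧ v.map f = u

/-- The alternation `0, 1, 0, 1, …` of length `s` on two letters. -/
def alternation (s : ℕ) : List ℕ := (List.range s).map (fun i => i % 2)

/-- `w` is the concatenation of `m` contiguous blocks, each consisting of pairwise distinct letters.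
Blocks may be empty. -/
def HasBlocks (m : ℕ) (w : List ℕ) : Prop :=
  ∃ B : List (List ℕ), B.length = m ∧ (∀ b ∈ B, b.Nodup) ∧ B.flatten = w

/-- The sequences over which the maximum `A_{s,k}(m)` is taken: sequences on `m` blocks which avoid
alternations of length `s` and in which every letter occurs at least `k` times. -/
def IsAdmissible (s k m : ℕ) (w : List ℕ) : Prop :=
  HasBlocks m w ∧ ¬ SeqContains w (alternation s) ∧ ∀ a ∈ w, k ≤ w.count a

/-- `A_{s,k}(m)`: the maximum number of distinct letters of an admissible sequence, with the
value `⊤` if these numbers are unbounded. -/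
noncomputable def maxLetters (s k m : ℕ) : ℕ∞ :=
  ⨆ w ∈ {w : List ℕ | IsAdmissible s k m w}, (w.toFinset.card : ℕ∞)

/-- The Ackermann hierarchy `A_1(n) = 2n`, and `A_k(0) = 1`, `A_k(n) = A_{k-1}(A_k(n-1))` for
`k ≥ 2`, `n ≥ 1`.  The hierarchy starts at index `1`; the value at index `0` is a placeholder. -/
def ackermannLevel : ℕ → ℕ → ℕ
  | 0, _ => 0
  | 1, n => 2 * n
  | _ + 2, 0 => 1
  | k + 2, n + 1 => ackermannLevel (k + 1) (ackermannLevel (k + 2) n)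
termination_by k n => (k, n)

/-- The inverse functions `α_k(x) = min {n : A_k(n) ≥ x}` for `k ≥ 1`. -/
noncomputable def inverseAckermannLevel (k x : ℕ) : ℕ :=
  sInf {n : ℕ | x ≤ ackermannLevel k n}

/-- The minimum that defines `α_k(x)` is over a nonempty set whenever `k ≥ 1`. -/
theorem le_ackermannLevel_succ (k x : ℕ) : x ≤ ackermannLevel (k + 1) x := by
  suffices h : ∀ k, (∀ x, x ≤ ackermannLevel (k + 1) x) ∧
      ∀ x, 1 ≤ x → x + 1 ≤ ackermannLevel (k + 1) x from (h k).1 x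
  intro k
  induction k with
  | zero => exact ⟨fun x => by rw [Nat.zero_add, ackermannLevel]; omega,
      fun x hx => by rw [Nat.zero_add, ackermannLevel]; omega⟩
  | succ k ih =>
    have key : ∀ x, x + 1 ≤ ackermannLevel (k + 2) x := by
      intro x
      induction x with
      | zero => simp only [ackermannLevel]; omega
      | succ n ihn =>
        simp only [ackermannLevel]
        have := ih.2 (ackermannLevel (k + 2) n) (by omega)
        omega
    exact ⟨fun x => (Nat.le_succ x).trans (key x), fun x _ => key x⟩

theorem inverseAckermannLevel_nonempty (k x : ℕ) (hk : 1 ≤ k) :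
    {n : ℕ | x ≤ ackermannLevel k n}.Nonempty := by
  obtain ⟨j, rfl⟩ := Nat.exists_eq_add_of_le' hk
  exact ⟨x, le_ackermannLevel_succ j x⟩

/-! Letters are sorted by how their occurrences are spread over the blocks. If two letters alternate
inside one part of the sequence and also occur outside it, the alternation can be prolonged, so
letters of such a class obey a bound for shorter alternations. `LetterBound` counts an arbitrary set
of letters, so a class can be bounded without deleting the other letters.

Merging the first two blocks costs an occurrence only to letters lying in both; these keep all but
two occurrences in the rest, where alternations two shorter are excluded. This is Pascal's
recursion, hence the binomial bound.

For alternations of length 5 the blocks are cut into layers (`letterBound_layers`). A letter with `k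
+ 2` occurrences either meets at least `k` layers, and is counted after contracting each layer to a
block, or is concentrated in one layer: all occurrences lie there, or the linear bounds for lengths
4 and 3 apply. If the layer size matches the per-block bound for `k`, contraction costs a constant
per block. Iterating from the quadratic bound at `k = 4` gives `log log`; from `m log m` at `k = 5`,
every two further occurrences raise the inverse Ackermann level by one. -/

/-- The alternation `a, b, a, b, …` of length `n`. -/
def altList (a b : ℕ) : ℕ → List ℕ
  | 0 => []
  | n + 1 => a :: altList b a n

theorem mem_altList {a b x : ℕ} : ∀ {n : ℕ}, x ∈ altList a b n → x = a ∨ x = b := by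
  intro n
  induction n generalizing a b with
  | zero => simp [altList]
  | succ n ih =>
    intro h
    rcases List.mem_cons.1 h with h | h
    · exact Or.inl h
    · exact (ih h).symm

theorem alternation_succ_succ (n : ℕ) : alternation (n + 2) = 0 :: 1 :: alternation n := by
  simp only [alternation, List.range_succ_eq_map, List.map_cons, List.map_map, List.cons.injEq]
  refine ⟨trivial, trivial, List.map_congr_left fun i _ => ?_⟩
  simp only [Function.comp_apply]
  omega

theorem map_altList {a b : ℕ} {f : ℕ → ℕ} (ha : f a = 0) (hb : f b = 1) :
    ∀ n, (altList a b n).map f = alternation n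
  | 0 => rfl
  | 1 => by simp [altList, ha, alternation]
  | n + 2 => by simp [altList, ha, hb, alternation_succ_succ, map_altList ha hb n]

theorem seqContains_alternation {a b s : ℕ} {w : List ℕ} (hab : a ≠ b)
    (h : (altList a b s).Sublist w) : SeqContains w (alternation s) := by
  refine ⟨_, h, fun x => if x = a then 0 else 1, ?_, map_altList (by simp) (by simp [hab.symm]) s⟩
  intro x hx y hy hxy
  rcases mem_altList hx with rfl | rfl <;> rcases mem_altList hy with rfl | rfl <;> simp_all

/-- In every sequence of at most `m` blocks, a set of letters with at least `k` occurrences each,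
no two of which form an alternation of length `s`, has at most `n` elements. -/
def LetterBound (s k m n : ℕ) : Prop :=
  ∀ (B : List (List ℕ)) (L : Finset ℕ), B.length ≤ m → (∀ b ∈ B, b.Nodup) →
    (∀ a ∈ L, k ≤ B.flatten.count a) →
    (∀ a ∈ L, ∀ b ∈ L, a ≠ b → ¬ (altList a b s).Sublist B.flatten) → L.card ≤ n

theorem LetterBound.maxLetters_le {s k m n : ℕ} (h : LetterBound s k m n) :
    maxLetters s k m ≤ n := by
  refine iSup₂_le fun w hw => ?_
  obtain ⟨⟨B, hm, hB, rfl⟩, hs, hk⟩ := hw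
  refine Nat.cast_le.2 (h B _ hm.le hB (fun a ha => hk a (List.mem_toFinset.1 ha)) ?_)
  exact fun a _ b _ hab hsub => hs (seqContains_alternation hab hsub)

theorem LetterBound.mono {s k m n k' m' n' : ℕ} (h : LetterBound s k m n) (hk : k ≤ k')
    (hm : m' ≤ m) (hn : n ≤ n') : LetterBound s k' m' n' :=
  fun B L hl hB hL hs => (h B L (hl.trans hm) hB (fun a ha => hk.trans (hL a ha)) hs).trans hn

theorem count_flatten_le_length {B : List (List ℕ)} (hB : ∀ b ∈ B, b.Nodup) (a : ℕ) :
    B.flatten.count a ≤ B.length := by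
  induction B with
  | nil => simp
  | cons b B ih =>
    have h1 := List.nodup_iff_count_le_one.1 (hB b (by simp)) a
    have h2 := ih fun c hc => hB c (by simp [hc])
    simp only [List.flatten_cons, List.count_append, List.length_cons]
    omega

theorem letterBound_of_lt {s k m : ℕ} (h : m < k) : LetterBound s k m 0 := by
  intro B L hl hB hL _
  rw [Nat.le_zero, Finset.card_eq_zero, Finset.eq_empty_iff_forall_notMem]
  intro a ha
  have := count_flatten_le_length hB a
  have := hL a ha
  omega

theorem exists_pair_sublist {a b : ℕ} (hab : a ≠ b) {l : List ℕ} (ha : a ∈ l) (hb : b ∈ l) :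
    [a, b].Sublist l ∨ [b, a].Sublist l := by
  obtain ⟨p, r, rfl⟩ := List.append_of_mem ha
  rcases List.mem_append.1 hb with h | h
  · right
    exact (List.singleton_sublist.2 h).append (List.singleton_sublist.2 (by simp))
  · left
    have : b ∈ r := by simpa [hab.symm] using h
    exact ((List.singleton_sublist.2 this).cons_cons a).trans (List.sublist_append_right _ _)

theorem letterBound_two_one (m : ℕ) : LetterBound 2 1 m (if m = 0 then 0 else 1) := by
  split_ifs with h
  · exact letterBound_of_lt (by omega)
  intro B L _ _ hL hs
  refine Finset.card_le_one.2 fun a ha b hb => ?_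
  by_contra hab
  have key : ∀ x ∈ L, x ∈ B.flatten := fun x hx => List.count_pos_iff.1 (hL x hx)
  rcases exists_pair_sublist hab (key a ha) (key b hb) with h | h
  · exact hs a ha b hb hab h
  · exact hs b hb a ha (Ne.symm hab) h

/-! ### Merging two blocks: the binomial bound -/

/-- Merging the first two blocks keeps the letters that occur in at most one of them; the other
letters satisfy the hypothesis `h₂`. -/
theorem letterBound_merge {s k m p q : ℕ} (hk : 2 ≤ k) (h₁ : LetterBound s k (m + 1) p)
    (h₂ : ∀ (b c : List ℕ) (B : List (List ℕ)) (L : Finset ℕ), B.length ≤ m →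
      (∀ d ∈ B, d.Nodup) → (∀ a ∈ L, a ∈ b ∧ a ∈ c ∧ k ≤ B.flatten.count a + 2) →
      (∀ x ∈ L, ∀ y ∈ L, x ≠ y → ¬ (altList x y s).Sublist (b ++ (c ++ B.flatten))) →
      L.card ≤ q) :
    LetterBound s k (m + 2) (p + q) := by
  intro B L hl hB hL hs
  match B, hl, hB, hL, hs with
  | [], _, hB, hL, hs =>
    exact (letterBound_of_lt (s := s) (k := k) (m := 0) (by omega) [] L le_rfl hB hL hs).trans
      (Nat.zero_le _)
  | [b], _, hB, hL, hs =>
    exact (letterBound_of_lt (s := s) (k := k) (m := 1) (by omega) [b] L le_rfl hB hL hs).trans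
      (Nat.zero_le _)
  | b :: c :: B, hl, hB, hL, hs =>
    rw [← Finset.card_filter_add_card_filter_not (fun a => ¬ (a ∈ b ∧ a ∈ c))]
    have hb : b.Nodup := hB b (by simp)
    have hc : c.Nodup := hB c (by simp)
    have hB' : ∀ d ∈ B, d.Nodup := fun d hd => hB d (by simp [hd])
    simp only [List.length_cons, List.flatten_cons] at hl hL hs
    refine Nat.add_le_add (h₁ ((b ++ c).dedup :: B) _ ?_ ?_ ?_ ?_) (h₂ b c B _ ?_ hB' ?_ ?_)
    · simp only [List.length_cons]; omega
    · intro d hd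
      rcases List.mem_cons.1 hd with rfl | hd
      · exact List.nodup_dedup _
      · exact hB' d hd
    · intro a ha
      obtain ⟨haL, ha⟩ := Finset.mem_filter.1 ha
      have := hL a haL
      have h3 : b.count a + c.count a ≤ (b ++ c).dedup.count a := by
        rw [hb.count, hc.count, (List.nodup_dedup _).count]
        simp only [List.mem_dedup, List.mem_append]
        by_cases h1 : a ∈ b <;> by_cases h2 : a ∈ c <;> simp [h1, h2]
        exact ha ⟨h1, h2⟩
      rw [List.count_append, List.count_append] at this
      rw [List.flatten_cons, List.count_append]
      omega
    · intro x hx y hy hxy h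
      refine hs x (Finset.mem_filter.1 hx).1 y (Finset.mem_filter.1 hy).1 hxy (h.trans ?_)
      rw [List.flatten_cons, ← List.append_assoc]
      exact (List.dedup_sublist _).append (List.Sublist.refl _)
    · omega
    · intro a ha
      obtain ⟨haL, ha⟩ := Finset.mem_filter.1 ha
      rw [not_not] at ha
      have h1 := hL a haL
      have h2 := List.nodup_iff_count_le_one.1 hb a
      have h3 := List.nodup_iff_count_le_one.1 hc a
      simp only [List.count_append] at h1
      exact ⟨ha.1, ha.2, by omega⟩
    · exact fun x hx y hy => hs x (Finset.mem_filter.1 hx).1 y (Finset.mem_filter.1 hy).1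

theorem letterBound_three_two (m : ℕ) : LetterBound 3 2 m (m - 1) := by
  induction m with
  | zero => exact letterBound_of_lt (by omega)
  | succ m ih =>
    cases m with
    | zero => exact letterBound_of_lt (by omega)
    | succ m =>
      refine letterBound_merge le_rfl ih (q := 1) fun b c B L _ _ hL hs => ?_
      refine Finset.card_le_one.2 fun x hx y hy => ?_
      by_contra hxy
      rcases exists_pair_sublist hxy (hL x hx).2.1 (hL y hy).2.1 with h | h
      · exact hs y hy x hx (Ne.symm hxy) ((List.singleton_sublist.2 (hL y hy).1).append
          (h.trans (List.sublist_append_left _ _)))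
      · exact hs x hx y hy hxy ((List.singleton_sublist.2 (hL x hx).1).append
          (h.trans (List.sublist_append_left _ _)))

/-- An `x` from the first block and a `y` from the second prefix any alternation `x, y, …` of the
remaining blocks. -/
theorem letterBound_add_two {s m p q : ℕ} (h₁ : LetterBound (s + 3) (s + 2) (m + 1) p)
    (h₂ : LetterBound (s + 1) s m q) : LetterBound (s + 3) (s + 2) (m + 2) (p + q) := by
  refine letterBound_merge (by omega) h₁ fun b c B L hl hB hL hs => ?_
  refine h₂ B L hl hB (fun a ha => by have := (hL a ha).2.2; omega) fun x hx y hy hxy h => ?_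
  exact hs x hx y hy hxy ((List.singleton_sublist.2 (hL x hx).1).append
    ((List.singleton_sublist.2 (hL y hy).2.1).append h))

theorem letterBound_choose {s : ℕ} (hs : 2 ≤ s) (m : ℕ) :
    LetterBound (s + 1) s m ((m - (s + 1) / 2).choose (s / 2)) := by
  induction s using Nat.strong_induction_on generalizing m with
  | _ s ihs =>
  obtain ⟨s, rfl⟩ := Nat.exists_eq_add_of_le' hs
  rcases Nat.eq_zero_or_pos s with rfl | hs0
  · simpa using letterBound_three_two m
  induction m with
  | zero => exact (letterBound_of_lt (by omega)).mono le_rfl le_rfl (Nat.zero_le _)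
  | succ m ih =>
  cases m with
  | zero => exact (letterBound_of_lt (by omega)).mono le_rfl le_rfl (Nat.zero_le _)
  | succ m =>
  -- Once `m < s` is excluded, the subtractions below are not truncated, as Pascal's rule requires.
  rcases Nat.lt_or_ge (m + 2) (s + 2) with hlt | hge
  · exact (letterBound_of_lt hlt).mono le_rfl le_rfl (Nat.zero_le _)
  rcases Nat.lt_or_ge s 2 with hs2 | hs2
  · obtain rfl : s = 1 := by omega
    refine (letterBound_add_two ih (letterBound_two_one m)).mono le_rfl le_rfl ?_
    norm_num
    split_ifs <;> omega
  · refine (letterBound_add_two ih (ihs s (by omega) hs2 m)).mono le_rfl le_rfl (le_of_eq ?_)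
    have e1 : m + 1 - (s + 2 + 1) / 2 = m - (s + 1) / 2 := by omega
    have e2 : m + 1 + 1 - (s + 2 + 1) / 2 = m - (s + 1) / 2 + 1 := by omega
    have e3 : (s + 2) / 2 = s / 2 + 1 := by omega
    rw [e1, e2, e3, Nat.choose_succ_succ, add_comm]

/-! ### Halving: five occurrences -/

theorem letterBound_four_three (m : ℕ) : LetterBound 4 3 m m :=
  (letterBound_choose (s := 3) (by omega) m).mono le_rfl le_rfl (by norm_num)

theorem letterBound_five_four (m : ℕ) : LetterBound 5 4 m (m * m) := by
  refine (letterBound_choose (s := 4) (by omega) m).mono le_rfl le_rfl ?_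
  norm_num
  refine (Nat.choose_le_pow _ 2).trans ?_
  rw [← sq]
  exact Nat.pow_le_pow_left (Nat.sub_le _ _) 2

/-- Of five occurrences, either all lie in one half, or one half has at least three and the other at
least one. In the latter case an alternation of length 4 in the first half extends to length 5 by a
letter of the other half, so the linear bound for length 4 applies. -/
theorem letterBound_halves {t n : ℕ} (h : LetterBound 5 5 t n) :
    LetterBound 5 5 (2 * t) (2 * n + 2 * t) := by
  classical
  intro B L hl hB hL hs
  obtain ⟨C, D, rfl, hC, hD⟩ : ∃ C D, B = C ++ D ∧ C.length ≤ t ∧ D.length ≤ t :=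
    ⟨B.take t, B.drop t, (List.take_append_drop _ _).symm, by simp, by simp; omega⟩
  have hBC : ∀ b ∈ C, b.Nodup := fun b hb => hB b (by simp [hb])
  have hBD : ∀ b ∈ D, b.Nodup := fun b hb => hB b (by simp [hb])
  simp only [List.flatten_append, List.count_append] at hL hs
  have h1 : (L.filter fun a => 5 ≤ C.flatten.count a).card ≤ n := by
    refine h C _ hC hBC (fun a ha => (Finset.mem_filter.1 ha).2) fun a ha b hb hab hsub => ?_
    exact hs a (Finset.mem_filter.1 ha).1 b (Finset.mem_filter.1 hb).1 hab
      (hsub.trans (List.sublist_append_left _ _))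
  have h2 : (L.filter fun a => 5 ≤ D.flatten.count a).card ≤ n := by
    refine h D _ hD hBD (fun a ha => (Finset.mem_filter.1 ha).2) fun a ha b hb hab hsub => ?_
    exact hs a (Finset.mem_filter.1 ha).1 b (Finset.mem_filter.1 hb).1 hab
      (hsub.trans (List.sublist_append_right _ _))
  have h3 : (L.filter fun a => 3 ≤ C.flatten.count a ∧ 1 ≤ D.flatten.count a).card ≤ t := by
    refine letterBound_four_three t C _ hC hBC (fun a ha => (Finset.mem_filter.1 ha).2.1)
      fun a ha b hb hab hsub => ?_
    exact hs a (Finset.mem_filter.1 ha).1 b (Finset.mem_filter.1 hb).1 hab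
      (hsub.append (List.singleton_sublist.2 (List.count_pos_iff.1 (Finset.mem_filter.1 ha).2.2)))
  have h4 : (L.filter fun a => 3 ≤ D.flatten.count a ∧ 1 ≤ C.flatten.count a).card ≤ t := by
    refine letterBound_four_three t D _ hD hBD (fun a ha => (Finset.mem_filter.1 ha).2.1)
      fun a ha b hb hab hsub => ?_
    exact hs b (Finset.mem_filter.1 hb).1 a (Finset.mem_filter.1 ha).1 hab.symm
      ((List.singleton_sublist.2
        (List.count_pos_iff.1 (Finset.mem_filter.1 hb).2.2)).append hsub)
  have hcov : L ⊆ ((L.filter fun a => 5 ≤ C.flatten.count a) ∪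
      (L.filter fun a => 5 ≤ D.flatten.count a)) ∪
      ((L.filter fun a => 3 ≤ C.flatten.count a ∧ 1 ≤ D.flatten.count a) ∪
      (L.filter fun a => 3 ≤ D.flatten.count a ∧ 1 ≤ C.flatten.count a)) := by
    intro a ha
    have := hL a ha
    simp only [Finset.mem_union, Finset.mem_filter, ha, true_and]
    omega
  have := Finset.card_le_card hcov
  have := Finset.card_union_le ((L.filter fun a => 5 ≤ C.flatten.count a) ∪
      (L.filter fun a => 5 ≤ D.flatten.count a))
      ((L.filter fun a => 3 ≤ C.flatten.count a ∧ 1 ≤ D.flatten.count a) ∪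
      (L.filter fun a => 3 ≤ D.flatten.count a ∧ 1 ≤ C.flatten.count a))
  have := Finset.card_union_le (L.filter fun a => 5 ≤ C.flatten.count a)
      (L.filter fun a => 5 ≤ D.flatten.count a)
  have := Finset.card_union_le
      (L.filter fun a => 3 ≤ C.flatten.count a ∧ 1 ≤ D.flatten.count a)
      (L.filter fun a => 3 ≤ D.flatten.count a ∧ 1 ≤ C.flatten.count a)
  omega

/-! ### Cutting into layers -/

theorem exists_layers {α : Type*} {t : ℕ} : ∀ {M : ℕ} {B : List α}, B.length ≤ M * t →
    ∃ C : List (List α), C.length = M ∧ (∀ l ∈ C, l.length ≤ t) ∧ C.flatten = B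
  | 0, B, h => ⟨[], rfl, by simp, by
      rw [Nat.zero_mul, Nat.le_zero, List.length_eq_zero_iff] at h; simp [h]⟩
  | M + 1, B, h => by
    obtain ⟨C, h1, h2, h3⟩ := exists_layers (t := t) (M := M) (B := B.drop t) (by
      rw [List.length_drop, Nat.sub_le_iff_le_add]; rwa [Nat.succ_mul] at h)
    refine ⟨B.take t :: C, by simp [h1], ?_, by simp [h3]⟩
    intro l hl
    rcases List.mem_cons.1 hl with rfl | hl
    · simp
    · exact h2 l hl

/-- Only the last positive entry can be 2. -/
theorem sum_le_countP_add_one {X : List ℕ}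
    (h : ∀ p x r, X = p ++ x :: r → x ≤ 2 ∧ (0 < r.sum → x ≤ 1)) :
    X.sum ≤ X.countP (0 < ·) + 1 := by
  induction X with
  | nil => simp
  | cons x X ih =>
    have h1 := h [] x X rfl
    have h2 := ih fun p y r e => h (x :: p) y r (by simp [e])
    rw [List.sum_cons, List.countP_cons]
    split_ifs with hx <;> simp at hx <;> omega

/-- With several positive entries only the first and the last can be 2, so the sum exceeds their
number by at most two. -/
theorem sum_le_of_countP_lt {k : ℕ} {X : List ℕ}
    (h : ∀ p x r, X = p ++ x :: r → x ≤ k + 1 ∧ (0 < r.sum → x ≤ 2) ∧ (0 < p.sum → x ≤ 2) ∧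
      (0 < p.sum → 0 < r.sum → x ≤ 1)) (hX : X.countP (0 < ·) < k) : X.sum ≤ k + 1 := by
  induction X with
  | nil => simp
  | cons x X ih =>
    have h1 := h [] x X rfl
    rw [List.sum_cons]
    rw [List.countP_cons] at hX
    rcases Nat.eq_zero_or_pos x with rfl | hx
    · have := ih (fun p y r e => by
        have := h (0 :: p) y r (by simp [e])
        simpa using this) (by omega)
      omega
    · have h2 := sum_le_countP_add_one (X := X) fun p y r e => by
        have := h (x :: p) y r (by simp [e])
        simp only [List.sum_cons] at this
        exact ⟨this.2.2.1 (by omega), this.2.2.2 (by omega)⟩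
      simp only [hx, decide_true, if_true] at hX
      omega

open Classical in
theorem card_exists_split_le {α : Type*} {C : List α} {L : Finset ℕ} {N : ℕ}
    {P : List α → α → List α → ℕ → Prop}
    (h : ∀ p x r, C = p ++ x :: r → (L.filter (P p x r)).card ≤ N) :
    (L.filter fun a => ∃ p x r, C = p ++ x :: r ∧ P p x r a).card ≤ C.length * N := by
  have hsub : (L.filter fun a => ∃ p x r, C = p ++ x :: r ∧ P p x r a) ⊆
      Finset.univ.biUnion fun i : Fin C.length =>
        L.filter (P (C.take i) C[i] (C.drop (i + 1))) := by
    intro a ha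
    obtain ⟨haL, p, x, r, rfl, hP⟩ := Finset.mem_filter.1 ha
    refine Finset.mem_biUnion.2 ⟨⟨p.length, by simp⟩, Finset.mem_univ _,
      Finset.mem_filter.2 ⟨haL, ?_⟩⟩
    simpa using hP
  refine (Finset.card_le_card hsub).trans ?_
  refine (Finset.card_biUnion_le_card_mul _ _ N fun i _ => h _ _ _ ?_).trans (by simp)
  simp

/-- Transfers a bound to a class of letters inside part of `w`. Either order of the two letters
suffices, since both are excluded in `w`. -/
theorem LetterBound.card_filter_le {s s' k m n : ℕ} (h : LetterBound s k m n)
    {B : List (List ℕ)} {w : List ℕ} {L : Finset ℕ} {P : ℕ → Prop} [DecidablePred P]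
    (hl : B.length ≤ m) (hB : ∀ b ∈ B, b.Nodup)
    (hs : ∀ a ∈ L, ∀ b ∈ L, a ≠ b → ¬ (altList a b s').Sublist w)
    (hP : ∀ a, P a → k ≤ B.flatten.count a)
    (hsub : ∀ a b, P a → P b → (altList a b s).Sublist B.flatten →
      (altList a b s').Sublist w ∨ (altList b a s').Sublist w) :
    (L.filter P).card ≤ n := by
  refine h B _ hl hB (fun a ha => hP a (Finset.mem_filter.1 ha).2) fun a ha b hb hab h => ?_
  obtain ⟨ha, hPa⟩ := Finset.mem_filter.1 ha
  obtain ⟨hb, hPb⟩ := Finset.mem_filter.1 hb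
  rcases hsub a b hPa hPb h with h | h
  · exact hs a ha b hb hab h
  · exact hs b hb a ha hab.symm h

theorem count_dedup_layers (C : List (List (List ℕ))) (a : ℕ) :
    (C.map fun l => l.flatten.dedup).flatten.count a =
      (C.map fun l => l.flatten.count a).countP (0 < ·) := by
  induction C with
  | nil => rfl
  | cons l C ih =>
    rw [List.map_cons, List.map_cons, List.flatten_cons, List.count_append, ih, List.countP_cons,
      (List.nodup_dedup _).count]
    simp only [List.mem_dedup, List.count_pos_iff, decide_eq_true_eq]
    omega

theorem sublist_dedup_layers (C : List (List (List ℕ))) :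
    (C.map fun l => l.flatten.dedup).flatten.Sublist C.flatten.flatten := by
  induction C with
  | nil => simp
  | cons l C ih =>
    simp only [List.map_cons, List.flatten_cons, List.flatten_append]
    exact (List.dedup_sublist _).append ih

theorem sum_count_layers (C : List (List (List ℕ))) (a : ℕ) :
    (C.map fun l => l.flatten.count a).sum = C.flatten.flatten.count a := by
  induction C with
  | nil => rfl
  | cons l C ih => simp [ih, List.count_append]

open Classical in
theorem letterBound_layers {k M t n₁ n₂ : ℕ} (h₁ : LetterBound 5 k M n₁)
    (h₂ : LetterBound 5 (k + 2) t n₂) :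
    LetterBound 5 (k + 2) (M * t) (n₁ + M * (n₂ + t + t + t)) := by
  intro B L hl hB hL hs
  obtain ⟨C, rfl, hCt, rfl⟩ := exists_layers hl
  -- The ways to be concentrated in the layer `x`. Reappearing on one side prolongs an alternation
  -- by one letter, on both sides by two.
  let P : List (List (List ℕ)) → List (List ℕ) → List (List (List ℕ)) → ℕ → Prop :=
    fun p x r a => k + 2 ≤ x.flatten.count a ∨
      (3 ≤ x.flatten.count a ∧ a ∈ r.flatten.flatten) ∨
      (3 ≤ x.flatten.count a ∧ a ∈ p.flatten.flatten) ∨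
      (2 ≤ x.flatten.count a ∧ a ∈ p.flatten.flatten ∧ a ∈ r.flatten.flatten)
  have hglob : (L.filter fun a =>
      k ≤ (C.map fun l => l.flatten.dedup).flatten.count a).card ≤ n₁ := by
    refine h₁.card_filter_le (by simp) (fun b hb => ?_) hs (fun a ha => ha)
      fun a b _ _ h => Or.inl (h.trans (sublist_dedup_layers C))
    obtain ⟨l, _, rfl⟩ := List.mem_map.1 hb
    exact List.nodup_dedup _
  have hloc : (L.filter fun a => ∃ p x r, C = p ++ x :: r ∧ P p x r a).card ≤
      C.length * (n₂ + t + t + t) := by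
    refine card_exists_split_le fun p x r hC => ?_
    have hxt : x.length ≤ t := hCt x (by simp [hC])
    have hx : ∀ b ∈ x, b.Nodup := fun b hb =>
      hB b (List.mem_flatten.2 ⟨x, by simp [hC], hb⟩)
    have hw : C.flatten.flatten = p.flatten.flatten ++ (x.flatten ++ r.flatten.flatten) := by
      simp [hC]
    rw [hw] at hs
    simp only [P, Finset.filter_or]
    have e1 : (L.filter fun a => k + 2 ≤ x.flatten.count a).card ≤ n₂ :=
      h₂.card_filter_le hxt hx hs (fun a ha => ha) fun a b _ _ h =>
        Or.inl ((h.trans (List.sublist_append_left _ _)).trans (List.sublist_append_right _ _))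
    have e2 : (L.filter fun a => 3 ≤ x.flatten.count a ∧ a ∈ r.flatten.flatten).card ≤ t :=
      (letterBound_four_three t).card_filter_le hxt hx hs (fun a ha => ha.1) fun a b ha _ h =>
        Or.inl ((h.append (List.singleton_sublist.2 ha.2)).trans (List.sublist_append_right _ _))
    have e3 : (L.filter fun a => 3 ≤ x.flatten.count a ∧ a ∈ p.flatten.flatten).card ≤ t :=
      (letterBound_four_three t).card_filter_le hxt hx hs (fun a ha => ha.1) fun a b _ hb h =>
        Or.inr ((List.singleton_sublist.2 hb.2).append (h.trans (List.sublist_append_left _ _)))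
    have e4 : (L.filter fun a => 2 ≤ x.flatten.count a ∧ a ∈ p.flatten.flatten ∧
        a ∈ r.flatten.flatten).card ≤ t :=
      ((letterBound_three_two t).mono le_rfl le_rfl (Nat.sub_le t 1)).card_filter_le hxt hx hs
        (fun a ha => ha.1) fun a b _ hb h => Or.inr ((List.singleton_sublist.2 hb.2.1).append
          (h.append (List.singleton_sublist.2 hb.2.2)))
    refine (Finset.card_union_le _ _).trans ?_
    rw [add_assoc, add_assoc]
    refine Nat.add_le_add e1 ((Finset.card_union_le _ _).trans (Nat.add_le_add e2 ?_))
    exact (Finset.card_union_le _ _).trans (Nat.add_le_add e3 e4)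
  refine le_trans (Finset.card_le_card ?_)
    ((Finset.card_union_le _ _).trans (Nat.add_le_add hglob hloc))
  intro a ha
  rw [← Finset.filter_or, Finset.mem_filter]
  refine ⟨ha, ?_⟩
  by_contra! hcon
  rw [count_dedup_layers] at hcon
  -- A letter in neither class has at most `k + 1` occurrences.
  have hsum := sum_le_of_countP_lt (k := k) (fun p x r e => ?_) hcon.1
  · rw [sum_count_layers] at hsum
    have := hL a ha
    omega
  · obtain ⟨p', y, hC, rfl, hy⟩ := List.map_eq_append_iff.1 e
    obtain ⟨x', r', rfl, rfl, rfl⟩ := List.map_eq_cons_iff.1 hy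
    have hP := hcon.2 p' x' r' hC
    simp only [P, not_or, not_and, not_le] at hP
    simp only [sum_count_layers, List.count_pos_iff]
    refine ⟨by omega, fun h => ?_, fun h => ?_, fun h h' => ?_⟩
    · by_contra h3
      exact hP.2.1 (by omega) h
    · by_contra h3
      exact hP.2.2.1 (by omega) h
    · by_contra h3
      exact hP.2.2.2 (by omega) h h'

/-! ### Numbers of blocks that are powers of two -/

/-- At most `c * 2 ^ j` letters on `2 ^ j` blocks, for alternations of length `5`. -/
def DyadicBound (k j c : ℕ) : Prop :=
  LetterBound 5 k (2 ^ j) (c * 2 ^ j)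

theorem DyadicBound.mono {k j c k' c' : ℕ} (h : DyadicBound k j c) (hk : k ≤ k') (hc : c ≤ c') :
    DyadicBound k' j c' :=
  LetterBound.mono h hk le_rfl (Nat.mul_le_mul_right _ hc)

theorem dyadicBound_zero {k j : ℕ} (hk : 5 ≤ k) (hj : j ≤ 2) : DyadicBound k j 0 := by
  have h1 : 2 ^ j ≤ 2 ^ 2 := Nat.pow_le_pow_right (by norm_num) hj
  exact (letterBound_of_lt (s := 5) (k := k) (m := 2 ^ j) (by omega)).mono le_rfl le_rfl
    (Nat.zero_le _)

theorem dyadicBound_layers {k i j c c' : ℕ} (hij : i ≤ j)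
    (h₁ : DyadicBound k (j - i) (c' * 2 ^ i)) (h₂ : DyadicBound (k + 2) i c) :
    DyadicBound (k + 2) j (c + 3 + c') := by
  have hpow : 2 ^ (j - i) * 2 ^ i = 2 ^ j := by rw [← pow_add, Nat.sub_add_cancel hij]
  refine (letterBound_layers h₁ h₂).mono le_rfl hpow.ge (le_of_eq ?_)
  rw [← hpow]
  ring

theorem dyadicBound_five (j : ℕ) : DyadicBound 5 j j := by
  induction j with
  | zero => exact dyadicBound_zero le_rfl (by norm_num)
  | succ j ih =>
    refine (letterBound_halves ih).mono le_rfl (by rw [pow_succ']) (le_of_eq ?_)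
    ring

theorem dyadicBound_four (j : ℕ) : DyadicBound 4 j (2 ^ j) :=
  letterBound_five_four _

/-- Layers of about the square root of the number of blocks balance the quadratic bound at `k = 4`;
each halving of `j` costs 4. -/
theorem dyadicBound_six {p j : ℕ} (h : j ≤ 2 ^ p) : DyadicBound 6 j (4 * p) := by
  induction p generalizing j with
  | zero => exact dyadicBound_zero (by norm_num) (by rw [pow_zero] at h; omega)
  | succ p ih =>
    rw [pow_succ] at h
    refine (dyadicBound_layers (k := 4) (i := j - j / 2) (by omega) (c' := 1) ?_
      (ih (by omega))).mono le_rfl (by omega)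
    refine (dyadicBound_four _).mono le_rfl ?_
    rw [one_mul]
    exact Nat.pow_le_pow_right (by norm_num) (by omega)

/-- The contracted sequence has per-block bound `j - i ≤ 2 ^ i`, the layer size. -/
theorem dyadicBound_extend {k i j c : ℕ} (hk : 5 ≤ k) (hij : i ≤ j) (hj : j ≤ i + 2 ^ i)
    (h : DyadicBound (k + 2) i c) : DyadicBound (k + 2) j (c + 4) := by
  refine dyadicBound_layers hij (c' := 1) ?_ h
  exact (dyadicBound_five _).mono hk (by omega)

/-! ### Climbing the Ackermann hierarchy -/

theorem ackermannLevel_two (n : ℕ) : ackermannLevel 2 n = 2 ^ n := by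
  induction n with
  | zero => simp [ackermannLevel]
  | succ n ih => rw [ackermannLevel, ih, ackermannLevel, pow_succ']

theorem ackermannLevel_one (d : ℕ) : ackermannLevel (d + 1) 1 = 2 := by
  induction d with
  | zero => simp [ackermannLevel]
  | succ d ih => rw [ackermannLevel, ackermannLevel, ih]

theorem ackermannLevel_two_right (d : ℕ) : ackermannLevel (d + 1) 2 = 4 := by
  induction d with
  | zero => simp [ackermannLevel]
  | succ d ih => rw [ackermannLevel, ackermannLevel_one, ih]

theorem exists_ackermannLevel_eq_two_pow (d n : ℕ) : ∃ i, ackermannLevel (d + 2) n = 2 ^ i := by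
  induction d generalizing n with
  | zero => exact ⟨n, ackermannLevel_two n⟩
  | succ d ih =>
    cases n with
    | zero => exact ⟨0, by rw [ackermannLevel, pow_zero]⟩
    | succ n => rw [ackermannLevel]; exact ih _

theorem dyadicBound_seven {n j : ℕ} (h : 2 ^ j ≤ ackermannLevel 3 n) :
    DyadicBound 7 j (8 * n) := by
  induction n generalizing j with
  | zero =>
    rw [ackermannLevel] at h
    have := j.lt_two_pow_self
    exact dyadicBound_zero (by norm_num) (by omega)
  | succ n ih =>
    rw [ackermannLevel, ackermannLevel_two] at h
    have hj := (Nat.pow_le_pow_iff_right (by norm_num)).1 h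
    obtain ⟨i, hi⟩ := exists_ackermannLevel_eq_two_pow 1 n
    rw [hi] at hj
    rcases Nat.le_total j i with hji | hij
    · exact (ih (j := j) (by rw [hi]; exact Nat.pow_le_pow_right (by norm_num) hji)).mono le_rfl
        (by omega)
    · exact (dyadicBound_extend (by norm_num) hij (by omega) (ih hi.ge)).mono le_rfl (by omega)

/-- The step from one level of the hierarchy to the next does not change the constant `8`: two
applications of the layer recursion cost `4` each, the first to layers of `8` times the size. -/
theorem dyadicBound_next_level {d k : ℕ} (hk : 5 ≤ k)
    (h : ∀ n j, 2 ^ j ≤ ackermannLevel (d + 2) n → DyadicBound k j (8 * n)) (n j : ℕ)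
    (hj : 2 ^ j ≤ ackermannLevel (d + 3) n) : DyadicBound (k + 2) j (8 * n) := by
  induction n generalizing j with
  | zero =>
    rw [ackermannLevel] at hj
    have := j.lt_two_pow_self
    exact dyadicBound_zero (by omega) (by omega)
  | succ n ih =>
    rw [ackermannLevel] at hj
    obtain ⟨i, hi⟩ := exists_ackermannLevel_eq_two_pow (d + 1) n
    rcases Nat.le_total j i with hji | hij
    · exact (ih j (by rw [hi]; exact Nat.pow_le_pow_right (by norm_num) hji)).mono le_rfl
        (by omega)
    rcases Nat.lt_or_ge 2 j with hj2 | hj2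
    swap
    · exact (dyadicBound_zero (by omega) hj2).mono le_rfl (Nat.zero_le _)
    rw [hi] at hj
    -- Every level takes the values 2 and 4 at 1 and 2, so `i < 2` would force `j ≤ 2`. This gives
    -- `3 ≤ 2 ^ i`, needed to extend from `i` to `i + 3`.
    have hi2 : 2 ≤ i := by
      by_contra! hlt
      have h4 : ackermannLevel (d + 2) (2 ^ i) ≤ 4 := by
        interval_cases i
        · exact (ackermannLevel_one (d + 1)).le.trans (by norm_num)
        · exact (ackermannLevel_two_right (d + 1)).le
      have h8 : 2 ^ j ≤ 2 ^ 2 := hj.trans h4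
      have := (Nat.pow_le_pow_iff_right (by norm_num)).1 h8
      omega
    have h4 : 2 ^ 2 ≤ 2 ^ i := Nat.pow_le_pow_right (by norm_num) hi2
    rcases Nat.le_total j (i + 3) with hj3 | hj3
    · exact (dyadicBound_extend hk hij (by omega) (ih i hi.ge)).mono le_rfl (by omega)
    -- The previous level gives `8 * 2 ^ i = 2 ^ (i + 3)` per block, whence the layer size.
    have h₁ : DyadicBound k (j - (i + 3)) (1 * 2 ^ (i + 3)) :=
      (h (2 ^ i) (j - (i + 3)) ((Nat.pow_le_pow_right (by norm_num) (Nat.sub_le _ _)).trans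
        hj)).mono le_rfl (by rw [pow_add]; omega)
    exact (dyadicBound_layers hj3 h₁ (dyadicBound_extend hk (Nat.le_add_right _ _) (by omega)
      (ih i hi.ge))).mono le_rfl (by omega)

theorem dyadicBound_of_le_ackermannLevel (d n j : ℕ) (h : 2 ^ j ≤ ackermannLevel (d + 3) n) :
    DyadicBound (2 * d + 7) j (8 * n) := by
  induction d generalizing n j with
  | zero => exact dyadicBound_seven h
  | succ d ih => exact dyadicBound_next_level (by omega) ih n j h

/-! ### Arbitrary numbers of blocks and real asymptotics -/

theorem DyadicBound.maxLetters_le {k m c : ℕ} (hk : 0 < k)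
    (h : DyadicBound k (Nat.clog 2 m) c) :
    maxLetters 5 k m ≤ ((c * (2 * m) : ℕ) : ℕ∞) := by
  rcases Nat.eq_zero_or_pos m with rfl | hm
  · exact ((letterBound_of_lt hk).mono le_rfl le_rfl (Nat.zero_le _)).maxLetters_le
  refine LetterBound.maxLetters_le (LetterBound.mono h le_rfl
    (Nat.le_pow_clog (by norm_num) m) (Nat.mul_le_mul_left _ ?_))
  rcases Nat.lt_or_ge 1 m with h1 | h1
  · have := Nat.pow_pred_clog_lt_self (b := 2) (by norm_num) h1
    have hc := Nat.clog_pos (b := 2) (by norm_num) h1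
    rw [← Nat.succ_pred_eq_of_pos hc, pow_succ']
    omega
  · obtain rfl : m = 1 := by omega
    simp

theorem le_ackermannLevel_inverse {k : ℕ} (hk : 1 ≤ k) (x : ℕ) :
    x ≤ ackermannLevel k (inverseAckermannLevel k x) :=
  Nat.sInf_mem (inverseAckermannLevel_nonempty k x hk)

theorem natCast_clog_le {x : ℕ} (hx : 2 ≤ x) : (Nat.clog 2 x : ℝ) ≤ 3 * Real.log x := by
  have hc := Nat.clog_pos (b := 2) (by norm_num) hx
  have h := Nat.pow_pred_clog_lt_self (b := 2) (by norm_num) hx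
  have hpos : (0 : ℝ) < x := by positivity
  -- Squaring absorbs the rounding up; 3 then exceeds `2 / log 2`.
  have h1 : (2 : ℝ) ^ (Nat.clog 2 x) ≤ x ^ 2 := by
    rw [← Nat.succ_pred_eq_of_pos hc, pow_succ, sq]
    have h' : (2 : ℝ) ^ (Nat.clog 2 x).pred ≤ x := by exact_mod_cast h.le
    exact mul_le_mul h' (by exact_mod_cast hx) (by norm_num) hpos.le
  have h2 := Real.log_le_log (by positivity) h1
  rw [Real.log_pow, Real.log_pow] at h2
  have h3 := Real.log_two_gt_d9
  have h4 : (0 : ℝ) ≤ Nat.clog 2 x := Nat.cast_nonneg _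
  push_cast at h2
  nlinarith

theorem natCast_clog_clog_le {x : ℕ} (hx : 27 ≤ x) :
    (Nat.clog 2 (Nat.clog 2 x) : ℝ) ≤ 6 * Real.log (Real.log x) := by
  have h1 : 2 ≤ Nat.clog 2 x := by
    by_contra! h
    have := Nat.le_pow_clog (b := 2) (by norm_num) x
    have : 2 ^ Nat.clog 2 x ≤ 2 ^ 1 := Nat.pow_le_pow_right (by norm_num) (by omega)
    omega
  have hlog : (3 : ℝ) ≤ Real.log x := by
    have h27 : Real.log (27 : ℝ) ≤ Real.log x :=
      Real.log_le_log (by norm_num) (by exact_mod_cast hx)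
    have he : (3 : ℝ) ≤ Real.log 27 := by
      rw [Real.le_log_iff_exp_le (by norm_num)]
      have := Real.exp_one_lt_d9
      have e : Real.exp 3 = Real.exp 1 ^ 3 := by rw [← Real.exp_nat_mul]; norm_num
      rw [e]
      calc Real.exp 1 ^ 3 ≤ 3 ^ 3 := by gcongr; linarith
        _ = 27 := by norm_num
    linarith
  refine (natCast_clog_le h1).trans ?_
  have h2 : (Nat.clog 2 x : ℝ) ≤ Real.log x ^ 2 := by
    have := natCast_clog_le (x := x) (by omega)
    nlinarith
  have h3 := Real.log_le_log (by exact_mod_cast (by omega : 0 < Nat.clog 2 x)) h2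
  rw [Real.log_pow] at h3
  push_cast at h3
  linarith

theorem natCast_toNat_le {x : ℕ∞} {n : ℕ} (h : x ≤ n) : (x.toNat : ℝ) ≤ n := by
  exact_mod_cast ENat.toNat_le_of_le_natCast h

/-- `toNat` sends `⊤` to `0`; the finiteness conjunct is what makes the later bounds meaningful.
Rounding `m` up to a power of two doubles each constant, so 8 becomes 16. -/
theorem mainTheorem2 :
    (∀ s m : ℕ, 2 ≤ s →
      maxLetters (s + 1) s m ≤ (((m - (s + 1) / 2).choose (s / 2) : ℕ) : ℕ∞)) ∧
    (∀ k m : ℕ, 5 ≤ k → maxLetters 5 k m ≠ ⊤) ∧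
    (fun m : ℕ => ((maxLetters 5 5 m).toNat : ℝ)) =O[Filter.atTop]
      (fun m : ℕ => (m : ℝ) * Real.log m) ∧
    (fun m : ℕ => ((maxLetters 5 6 m).toNat : ℝ)) =O[Filter.atTop]
      (fun m : ℕ => (m : ℝ) * Real.log (Real.log m)) ∧
    (∃ C : ℝ, ∀ k : ℕ, 7 ≤ k → ∀ m : ℕ,
      ((maxLetters 5 k m).toNat : ℝ) ≤
        C * ((m : ℝ) * (inverseAckermannLevel ((k - 1) / 2) m : ℝ))) := by
  refine ⟨fun s m hs => (letterBound_choose hs m).maxLetters_le, fun k m hk => ?_, ?_, ?_, 16,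
    fun k hk m => ?_⟩
  · exact ne_top_of_le_ne_top (ENat.natCast_ne_top _)
      (DyadicBound.maxLetters_le (by omega) ((dyadicBound_five _).mono hk le_rfl))
  · refine Asymptotics.IsBigO.of_bound 6 ?_
    filter_upwards [Filter.eventually_ge_atTop 2] with m hm
    have h1 := natCast_toNat_le (DyadicBound.maxLetters_le (by omega) (dyadicBound_five (Nat.clog 2 m)))
    have h2 := natCast_clog_le hm
    have h3 : (0 : ℝ) ≤ m := Nat.cast_nonneg m
    rw [Real.norm_of_nonneg (Nat.cast_nonneg _)]
    refine le_trans ?_ (mul_le_mul_of_nonneg_left (Real.le_norm_self _) (by norm_num))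
    push_cast at h1
    nlinarith [mul_le_mul_of_nonneg_right h2 h3]
  · refine Asymptotics.IsBigO.of_bound 48 ?_
    filter_upwards [Filter.eventually_ge_atTop 27] with m hm
    have h1 := natCast_toNat_le (DyadicBound.maxLetters_le (by omega)
      (dyadicBound_six (Nat.le_pow_clog (b := 2) (by norm_num) (Nat.clog 2 m))))
    have h2 := natCast_clog_clog_le hm
    have h3 : (0 : ℝ) ≤ m := Nat.cast_nonneg m
    rw [Real.norm_of_nonneg (Nat.cast_nonneg _)]
    refine le_trans ?_ (mul_le_mul_of_nonneg_left (Real.le_norm_self _) (by norm_num))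
    push_cast at h1
    nlinarith [mul_le_mul_of_nonneg_right h2 h3]
  · obtain ⟨d, hd⟩ : ∃ d, (k - 1) / 2 = d + 3 := ⟨(k - 1) / 2 - 3, by omega⟩
    rw [hd]
    -- The Ackermann values here are powers of two, so rounding `m` up does not overshoot them.
    have hj : 2 ^ Nat.clog 2 m ≤
        ackermannLevel (d + 3) (inverseAckermannLevel (d + 3) m) := by
      have hm := le_ackermannLevel_inverse (k := d + 3) (by omega) m
      obtain ⟨i, hi⟩ := exists_ackermannLevel_eq_two_pow (d + 1) (inverseAckermannLevel (d + 3) m)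
      rw [hi] at hm ⊢
      exact Nat.pow_le_pow_right (by norm_num) (Nat.clog_le_of_le_pow hm)
    have h1 := natCast_toNat_le (DyadicBound.maxLetters_le (by omega)
      ((dyadicBound_of_le_ackermannLevel d _ _ hj).mono (k' := k) (by omega) le_rfl))
    push_cast at h1
    linarith
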